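/- Let $N\ge 1$ be an integer, let $w\ge 0$ be an even integer, and let $\Gamma=\Gamma_0(N)\subset\Gamma_1=\mathrm{SL}_2(\mathbb{Z})$. Put $S=\begin{pmatrix}0&-1\\1&0\end{pmatrix}$ and $U=\begin{pmatrix}1&-1\\1&0\end{pmatrix}$. For a commutative ring $A$ let $V_w(A)$ be the $A$-module of polynomials of degree at most $w$ with coefficients in $A$, with the right action $(P|_{-w}\gamma)(X)=P(\gamma X)(cX+d)^w$ of $\gamma=\begin{pmatrix}a&b\\c&d\end{pmatrix}\in\Gamma_1$. Let $V_w(N)_{/A}$ be the $A$-module of maps $P:\Gamma\backslash\Gamma_1\to V_w(A)$, with the right action $(P|\gamma)(C)=P(C\gamma^{-1})|_{-w}\gamma$ for $C\in\Gamma\backslash\Gamma_1$, $\gamma\in\Gamma_1$, and let $$W_w(N)_{/A}=\{P\in V_w(N)_{/A} : P|(1+S)=P|(1+U+U^2)=0\}$$ be the space of period polynomials. Let $R$ be a discrete valuation ring whose residue field $F$ has characteristic $\ell>w$, $\ell\ne 2,3$, and assume that it is not the case that both $\ell\mid N$ and $w=\ell-1$. Then the reduction map $W_w(N)_{/R}\to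 W_w(N)_{/F}$, which reduces the coefficients of all polynomials modulo the maximal ideal of $R$, is surjective. -/

import Mathlib

open Polynomial
open scoped MatrixGroups

namespace PeriodPolynomial

noncomputable section

/-- `V_w(R)`: polynomials of degree at most `w` with coefficients in `R`. -/
abbrev V (w : ℕ) (R : Type*) [CommRing R] : Type _ := Polynomial.degreeLE R (w : WithBot ℕ)

/-- For `γ = (a b; c d)` the polynomial `(aX + b)^i (cX + d)^(w - i)`, that is,
the image of `X^i` under the weight `-w` action of `γ`. -/
def slashMonomial (w : ℕ) (R : Type*) [CommRing R] (γ : SL(2, ℤ)) (i : ℕ) : R[X] :=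
  (C ((γ 0 0 : ℤ) : R) * X + C ((γ 0 1 : ℤ) : R)) ^ i *
    (C ((γ 1 0 : ℤ) : R) * X + C ((γ 1 1 : ℤ) : R)) ^ (w - i)

theorem slashMonomial_mem (w : ℕ) (R : Type*) [CommRing R] (γ : SL(2, ℤ)) {i : ℕ} (hi : i ≤ w) :
    slashMonomial w R γ i ∈ Polynomial.degreeLE R (w : WithBot ℕ) := by
  rw [Polynomial.mem_degreeLE]
  apply Polynomial.degree_le_of_natDegree_le
  have h1 := Polynomial.natDegree_pow_le_of_le i
    (Polynomial.natDegree_linear_le (a := ((γ 0 0 : ℤ) : R)) (b := ((γ 0 1 : ℤ) : R)))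
  have h2 := Polynomial.natDegree_pow_le_of_le (w - i)
    (Polynomial.natDegree_linear_le (a := ((γ 1 0 : ℤ) : R)) (b := ((γ 1 1 : ℤ) : R)))
  refine (Polynomial.natDegree_mul_le_of_le h1 h2).trans ?_
  omega

/-- The weight `-w` action on `V_w(R)`:
`(P|_{-w} γ)(X) = P(γX) (cX + d)^w = ∑ i ≤ w, p_i (aX + b)^i (cX + d)^(w - i)`
for `γ = (a b; c d)` and `P = ∑ i ≤ w, p_i X^i`. -/
def slash (w : ℕ) (R : Type*) [CommRing R] (γ : SL(2, ℤ)) : V w R →ₗ[R] V w R where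
  toFun P := ⟨∑ i ∈ Finset.range (w + 1), (P : R[X]).coeff i • slashMonomial w R γ i,
    Submodule.sum_mem _ fun _ hi => Submodule.smul_mem _ _
      (slashMonomial_mem w R γ (Nat.lt_succ_iff.mp (Finset.mem_range.mp hi)))⟩
  map_add' P Q := by
    ext1
    simp [add_smul, Finset.sum_add_distrib]
  map_smul' r P := by
    ext1
    simp [mul_smul, Finset.smul_sum]

/-- The set `Γ₀(N) \ SL₂(ℤ)` of cosets `Γ₀(N) g`. -/
abbrev Cosets (N : ℕ) : Type :=
  Quotient (QuotientGroup.rightRel (CongruenceSubgroup.Gamma0 N))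

/-- Right translation `Γ₀(N) g ↦ Γ₀(N) g h` on cosets. -/
def Cosets.mulRight {N : ℕ} (A : Cosets N) (h : SL(2, ℤ)) : Cosets N :=
  Quotient.map' (fun g => g * h) (fun a b hab => by
    rw [QuotientGroup.rightRel_apply] at hab ⊢
    simpa [mul_assoc] using hab) A

/-- `V_w(N)_{/R}`: maps `Γ₀(N) \ SL₂(ℤ) → V_w(R)`. -/
abbrev VN (N w : ℕ) (R : Type*) [CommRing R] : Type _ := Cosets N → V w R

/-- The action of `SL₂(ℤ)` on `V_w(N)_{/R}`: `(P|γ)(A) = P(A γ⁻¹)|_{-w} γ`. -/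
def act (N w : ℕ) (R : Type*) [CommRing R] (γ : SL(2, ℤ)) : VN N w R →ₗ[R] VN N w R where
  toFun P A := slash w R γ (P (A.mulRight γ⁻¹))
  map_add' P Q := by
    funext A
    simp
  map_smul' r P := by
    funext A
    simp

/-- The matrix `S = (0 -1; 1 0)`. -/
def S : SL(2, ℤ) := ⟨!![0, -1; 1, 0], by simp [Matrix.det_fin_two]⟩

/-- The matrix `U = (1 -1; 1 0)`. -/
def U : SL(2, ℤ) := ⟨!![1, -1; 1, 0], by simp [Matrix.det_fin_two]⟩

/-- The space `W_w(N)_{/R}` of period polynomials: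
those `P` in `V_w(N)_{/R}` with `P|(1 + S) = 0` and `P|(1 + U + U²) = 0`. -/
def W (N w : ℕ) (R : Type*) [CommRing R] : Submodule R (VN N w R) :=
  LinearMap.ker (LinearMap.id + act N w R S) ⊓
    LinearMap.ker (LinearMap.id + act N w R U + act N w R (U ^ 2))

section Map

variable {R R' : Type*} [CommRing R] [CommRing R']

/-- Applying a ring homomorphism to the coefficients of an element of `V_w(R)`. -/
def mapV (w : ℕ) (f : R →+* R') : V w R →ₛₗ[f] V w R' where
  toFun P := ⟨(P : R[X]).map f, Polynomial.mem_degreeLE.mpr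
    (Polynomial.degree_map_le.trans (Polynomial.mem_degreeLE.mp P.2))⟩
  map_add' P Q := by
    ext1
    simp
  map_smul' r P := by
    ext1
    simp [Polynomial.map_smul]

theorem mapV_slash (w : ℕ) (f : R →+* R') (γ : SL(2, ℤ)) (P : V w R) :
    mapV w f (slash w R γ P) = slash w R' γ (mapV w f P) := by
  ext1
  simp [mapV, slash, slashMonomial, Polynomial.map_sum, Polynomial.map_smul]

/-- Applying a ring homomorphism to the coefficients of an element of `V_w(N)_{/R}`. -/
def mapVN (N w : ℕ) (f : R →+* R') : VN N w R →ₛₗ[f] VN N w R' where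
  toFun P A := mapV w f (P A)
  map_add' P Q := by
    funext A
    simp
  map_smul' r P := by
    funext A
    simp

theorem mapVN_act (N w : ℕ) (f : R →+* R') (γ : SL(2, ℤ)) (P : VN N w R) :
    mapVN N w f (act N w R γ P) = act N w R' γ (mapVN N w f P) := by
  funext A
  exact mapV_slash w f γ _

theorem mapVN_mem_W (N w : ℕ) (f : R →+* R') (P : VN N w R) (hP : P ∈ W N w R) :
    mapVN N w f P ∈ W N w R' := by
  obtain ⟨h1, h2⟩ := Submodule.mem_inf.mp hP
  rw [LinearMap.mem_ker] at h1 h2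
  refine Submodule.mem_inf.mpr ⟨?_, ?_⟩ <;> rw [LinearMap.mem_ker]
  · simpa [mapVN_act] using congrArg (mapVN N w f) h1
  · simpa [mapVN_act] using congrArg (mapVN N w f) h2

/-- The map `W_w(N)_{/R} → W_w(N)_{/R'}` induced by a ring homomorphism `R → R'`
on coefficients. -/
def mapW (N w : ℕ) (f : R →+* R') : W N w R →ₛₗ[f] W N w R' :=
  (mapVN N w f).restrict (mapVN_mem_W N w f)

end Map

/-- The reduction map `W_w(N)_{/R} → W_w(N)_{/F}` for a local ring `R` with residue field `F`. -/
def reduction (N w : ℕ) (R : Type*) [CommRing R] [IsLocalRing R] :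
    W N w R →ₛₗ[IsLocalRing.residue R] W N w (IsLocalRing.ResidueField R) :=
  mapW N w (IsLocalRing.residue R)

end

end PeriodPolynomial

/-! `W` is the kernel of the sum map `kerS ⊕ kerU → VN`, so a period polynomial over the residue
field lifts as soon as `VN / (kerS + kerU)` has no `ϖ`-torsion
(`reduction_surjective_of_torsionFree`). Since `S` and `U` generate `SL(2, ℤ)`, `SL(2, ℤ)` acts
trivially on this quotient (`sub_act_mem`). As in Shapiro's lemma, everything can then be moved to
the base coset, where `Γ₀(N)` acts on `V w R`.

For `w = 0` the sum over cosets has kernel exactly `kerS + kerU`, so the quotient embeds in the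
torsion-free module `V 0 R`. For `w > 0` the quotient vanishes: `(X + 1) ^ (n + 1) - X ^ (n + 1)`
has unit leading coefficient `n + 1 ≤ w < ℓ`, which kills all degrees below `w`. The top degree is
killed by `(N X + 1) ^ w - 1` if `ℓ ∤ N`, and otherwise by a matrix in `Γ₀(N)` with upper left entry
`a` such that `a ^ w ≢ 1` mod `ℓ`, which exists because `w < ℓ - 1`. -/

namespace PeriodPolynomial

open Polynomial Matrix
open scoped MatrixGroups

noncomputable section

variable {R : Type*} [CommRing R] {N w : ℕ}

/-! ### The weight `-w` action as substitution in binary forms -/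

/-- The linear form `γ i 0 * X + γ i 1` given by a row of `γ`. -/
def rowForm (R : Type*) [CommRing R] (γ : SL(2, ℤ)) (i : Fin 2) : R[X] :=
  C ((γ i 0 : ℤ) : R) * X + C ((γ i 1 : ℤ) : R)

/-- In homogeneous form the action is a linear substitution, so that `slash_mul` becomes composition
of substitutions. -/
theorem coe_slash (γ : SL(2, ℤ)) (P : V w R) :
    (slash w R γ P : R[X]) =
      MvPolynomial.aeval (rowForm R γ) ((P : R[X]).homogenize w) := by
  simp only [slash, slashMonomial, LinearMap.coe_mk, AddHom.coe_mk, homogenize, map_sum,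
    rowForm, MvPolynomial.aeval_monomial, Finset.Nat.sum_antidiagonal_eq_sum_range_succ_mk]
  refine Finset.sum_congr rfl fun i _ => ?_
  simp [Finsupp.prod_fintype, Fin.prod_univ_two, Polynomial.smul_eq_C_mul]

theorem coe_slash_X_pow (γ : SL(2, ℤ)) {i : ℕ} (P : V w R) (hP : (P : R[X]) = X ^ i)
    (hi : i ≤ w) :
    (slash w R γ P : R[X]) = rowForm R γ 0 ^ i * rowForm R γ 1 ^ (w - i) := by
  simp [coe_slash, hP, homogenize_X_pow hi]

theorem natDegree_rowForm_le (γ : SL(2, ℤ)) (i : Fin 2) : (rowForm R γ i).natDegree ≤ 1 :=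
  natDegree_linear_le

theorem natDegree_le_of_V (P : V w R) : (P : R[X]).natDegree ≤ w :=
  natDegree_le_of_degree_le (mem_degreeLE.mp P.2)

theorem homogenize_rowForm (γ : SL(2, ℤ)) (i : Fin 2) :
    (rowForm R γ i).homogenize 1 =
      .C ((γ i 0 : ℤ) : R) * .X 0 + .C ((γ i 1 : ℤ) : R) * .X 1 := by
  rw [rowForm, homogenize_add, homogenize_C_mul, homogenize_C, homogenize_X one_ne_zero]
  simp

theorem slash_one (P : V w R) : slash w R 1 P = P := by
  ext1
  have : rowForm R (1 : SL(2, ℤ)) = ![X, 1] := by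
    ext1 i
    fin_cases i <;> simp [rowForm]
  rw [coe_slash, this, aeval_homogenize_X_one _ (natDegree_le_of_V P)]

theorem slash_mul (γ δ : SL(2, ℤ)) (P : V w R) :
    slash w R (γ * δ) P = slash w R δ (slash w R γ P) := by
  ext1
  -- A form of degree `w` is determined by its dehomogenization.
  have key : (MvPolynomial.aeval (rowForm R γ) ((P : R[X]).homogenize w)).homogenize w =
      MvPolynomial.aeval (fun i => (rowForm R γ i).homogenize 1) ((P : R[X]).homogenize w) := by
    apply homogenize_eq_of_isHomogeneous
    · simpa using (isHomogeneous_homogenize (n := w) (P : R[X])).aeval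
        (fun i => (rowForm R γ i).homogenize 1) (fun i => isHomogeneous_homogenize _)
    · rw [← AlgHom.comp_apply, MvPolynomial.comp_aeval]
      congr 2
      funext i
      exact aeval_homogenize_X_one _ (natDegree_rowForm_le γ i)
  rw [coe_slash, coe_slash, coe_slash, key, ← AlgHom.comp_apply, MvPolynomial.comp_aeval]
  congr 2
  funext i
  rw [homogenize_rowForm]
  simp only [map_add, map_mul, MvPolynomial.aeval_X, MvPolynomial.aeval_C, algebraMap_eq]
  have hmul (j : Fin 2) : (γ * δ) i j = γ i 0 * δ 0 j + γ i 1 * δ 1 j := by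
    rw [← Fin.sum_univ_two (fun k => γ i k * δ k j)]
    exact Matrix.mul_apply
  simp only [rowForm, hmul, Int.cast_add, Int.cast_mul, C_add, C_mul]
  ring

theorem slash_weight_zero (γ : SL(2, ℤ)) (P : V 0 R) : slash 0 R γ P = P := by
  ext1
  nth_rw 2 [← slash_one P]
  simp [slash, slashMonomial]

theorem slash_neg_one (hw : Even w) (P : V w R) : slash w R (-1) P = P := by
  ext1
  nth_rw 2 [← slash_one P]
  simp only [slash, slashMonomial, LinearMap.coe_mk, AddHom.coe_mk]
  refine Finset.sum_congr rfl fun i hi => ?_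
  have hi' : i ≤ w := Nat.lt_succ_iff.mp (Finset.mem_range.mp hi)
  have : (-1 : R[X]) ^ i * (-1) ^ (w - i) = 1 := by
    rw [← pow_add, Nat.add_sub_of_le hi', hw.neg_one_pow]
  congr 1
  simp [neg_pow (X : R[X]) i, mul_right_comm _ _ ((-1 : R[X]) ^ (w - i)), this]

/-! ### Right translation of cosets and the action on `VN` -/

namespace Cosets

theorem mulRight_mulRight (A : Cosets N) (g h : SL(2, ℤ)) :
    (A.mulRight g).mulRight h = A.mulRight (g * h) := by
  induction A using Quotient.inductionOn'
  simp [mulRight, mul_assoc]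

theorem mulRight_one (A : Cosets N) : A.mulRight 1 = A := by
  induction A using Quotient.inductionOn'
  simp [mulRight]

theorem mulRight_neg_one (A : Cosets N) : A.mulRight (-1) = A := by
  induction A using Quotient.inductionOn' with
  | h a =>
    simp only [mulRight, Quotient.map'_mk'']
    apply Quotient.sound'
    rw [QuotientGroup.rightRel_apply]
    simp [CongruenceSubgroup.Gamma0_mem]

theorem mulRight_inv_eq_iff (A B : Cosets N) (g : SL(2, ℤ)) :
    A.mulRight g⁻¹ = B ↔ A = B.mulRight g := by
  constructor <;> rintro rfl <;> simp [mulRight_mulRight, mulRight_one]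

end Cosets

theorem act_one (P : VN N w R) : act N w R 1 P = P := by
  funext A
  simp [act, slash_one, Cosets.mulRight_one]

theorem act_mul (γ δ : SL(2, ℤ)) (P : VN N w R) :
    act N w R (γ * δ) P = act N w R δ (act N w R γ P) := by
  funext A
  simp [act, slash_mul, Cosets.mulRight_mulRight]

theorem act_neg_one (hw : Even w) (P : VN N w R) : act N w R (-1) P = P := by
  funext A
  simp [act, slash_neg_one hw, Cosets.mulRight_neg_one]

theorem S_mul_S : S * S = -1 := by
  decide

theorem U_pow_three : U ^ 2 * U = -1 := by
  decide

theorem act_S_act_S (hw : Even w) (P : VN N w R) : act N w R S (act N w R S P) = P := by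
  rw [← act_mul, S_mul_S, act_neg_one hw]

theorem act_U_act_U (P : VN N w R) : act N w R U (act N w R U P) = act N w R (U ^ 2) P := by
  rw [← act_mul, pow_two]

theorem act_U_act_U_sq (hw : Even w) (P : VN N w R) :
    act N w R U (act N w R (U ^ 2) P) = P := by
  rw [← act_mul, U_pow_three, act_neg_one hw]

theorem act_U_sq_act_U (hw : Even w) (P : VN N w R) :
    act N w R (U ^ 2) (act N w R U P) = P := by
  rw [← act_U_act_U, act_U_act_U P, act_U_act_U_sq hw]

theorem act_U_sq_act_U_sq (hw : Even w) (P : VN N w R) :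
    act N w R (U ^ 2) (act N w R (U ^ 2) P) = act N w R U P := by
  rw [← act_U_act_U, act_U_act_U_sq hw]

/-! ### The two kernels and the coinvariants -/

/-- The kernel of `1 + S` on `V_w(N)`. -/
def kerS (N w : ℕ) (R : Type*) [CommRing R] : Submodule R (VN N w R) :=
  LinearMap.ker (LinearMap.id + act N w R S)

/-- The kernel of `1 + U + U²` on `V_w(N)`. -/
def kerU (N w : ℕ) (R : Type*) [CommRing R] : Submodule R (VN N w R) :=
  LinearMap.ker (LinearMap.id + act N w R U + act N w R (U ^ 2))

theorem mem_kerS {P : VN N w R} : P ∈ kerS N w R ↔ P + act N w R S P = 0 := Iff.rfl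

theorem mem_kerU {P : VN N w R} :
    P ∈ kerU N w R ↔ P + act N w R U P + act N w R (U ^ 2) P = 0 := Iff.rfl

theorem sub_act_S_mem_kerS (hw : Even w) (P : VN N w R) : P - act N w R S P ∈ kerS N w R := by
  rw [mem_kerS, map_sub, act_S_act_S hw]
  abel

theorem sub_act_U_mem_kerU (hw : Even w) (P : VN N w R) : P - act N w R U P ∈ kerU N w R := by
  rw [mem_kerU, map_sub, map_sub, act_U_act_U, act_U_sq_act_U hw]
  abel

theorem sub_act_U_sq_mem_kerU (hw : Even w) (P : VN N w R) :
    P - act N w R (U ^ 2) P ∈ kerU N w R := by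
  rw [mem_kerU, map_sub, map_sub, act_U_act_U_sq hw, act_U_sq_act_U_sq hw]
  abel

/-- The set of `γ` acting trivially on the quotient by a submodule `M` is a subgroup. -/
def trivialOn (M : Submodule R (VN N w R)) : Subgroup SL(2, ℤ) where
  carrier := {γ | ∀ P, P - act N w R γ P ∈ M}
  one_mem' P := by simp [act_one]
  mul_mem' {γ δ} hγ hδ P := by
    rw [act_mul, ← sub_add_sub_cancel P (act N w R γ P)]
    exact M.add_mem (hγ P) (hδ _)
  inv_mem' {γ} hγ P := by
    have := M.neg_mem (hγ (act N w R γ⁻¹ P))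
    rwa [← act_mul, inv_mul_cancel, act_one, neg_sub] at this

theorem subgroup_eq_top_of_S_mem_of_U_mem {H : Subgroup SL(2, ℤ)} (hS : S ∈ H) (hU : U ∈ H) :
    H = ⊤ := by
  rw [eq_top_iff, ← SpecialLinearGroup.SL2Z_generators, Subgroup.closure_le]
  have hT : ModularGroup.T = U * S⁻¹ := by
    rw [eq_mul_inv_iff_mul_eq]
    decide
  rintro _ (rfl | rfl)
  · exact hS
  · rw [hT]
    exact H.mul_mem hU (H.inv_mem hS)

theorem sub_act_mem (hw : Even w) (γ : SL(2, ℤ)) (P : VN N w R) :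
    P - act N w R γ P ∈ kerS N w R ⊔ kerU N w R := by
  have : trivialOn (kerS N w R ⊔ kerU N w R) = ⊤ :=
    subgroup_eq_top_of_S_mem_of_U_mem
      (fun P => Submodule.mem_sup_left (sub_act_S_mem_kerS hw P))
      (fun P => Submodule.mem_sup_right (sub_act_U_mem_kerU hw P))
  exact (this ▸ Subgroup.mem_top γ : γ ∈ trivialOn _) P

/-! ### Moving everything to the base coset -/

open Classical in
/-- The function supported on a single coset. -/
def single (A : Cosets N) : V w R →ₗ[R] VN N w R :=
  LinearMap.single R (fun _ : Cosets N => V w R) A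

open Classical in
theorem single_apply (A B : Cosets N) (v : V w R) :
    single A v B = if B = A then v else 0 := by
  simp [single, Pi.single_apply]

theorem act_single (γ : SL(2, ℤ)) (A : Cosets N) (v : V w R) :
    act N w R γ (single A v) = single (A.mulRight γ) (slash w R γ v) := by
  funext B
  simp only [act, LinearMap.coe_mk, AddHom.coe_mk, single_apply]
  have hiff := Cosets.mulRight_inv_eq_iff B A γ
  by_cases h : B = A.mulRight γ
  · rw [if_pos h, if_pos (hiff.mpr h)]
  · rw [if_neg h, if_neg (mt hiff.mp h), map_zero]

theorem eq_sum_single [Fintype (Cosets N)] (P : VN N w R) : P = ∑ A, single A (P A) := by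
  funext B
  simp [Finset.sum_apply, single_apply]

/-- The class of the identity. -/
def baseCoset (N : ℕ) : Cosets N := Quotient.mk'' 1

theorem exists_baseCoset_mulRight (A : Cosets N) : ∃ g, A.mulRight g = baseCoset N := by
  induction A using Quotient.inductionOn' with
  | h a => exact ⟨a⁻¹, by simp [Cosets.mulRight, baseCoset]⟩

theorem baseCoset_mulRight {γ : SL(2, ℤ)} (hγ : γ ∈ CongruenceSubgroup.Gamma0 N) :
    (baseCoset N).mulRight γ = baseCoset N := by
  simp only [Cosets.mulRight, baseCoset, Quotient.map'_mk'']
  apply Quotient.sound'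
  rw [QuotientGroup.rightRel_apply]
  simpa using hγ

theorem single_sub_single_mem (hw : Even w) (A : Cosets N) (γ : SL(2, ℤ)) (v : V w R) :
    single A v - single (A.mulRight γ) (slash w R γ v) ∈ kerS N w R ⊔ kerU N w R := by
  rw [← act_single]
  exact sub_act_mem hw γ _

/-- The polynomials of degree at most `w` which vanish in the coinvariants when placed at the
base coset. -/
def baseKernel (N w : ℕ) (R : Type*) [CommRing R] : Submodule R R[X] :=
  ((kerS N w R ⊔ kerU N w R).comap (single (baseCoset N))).map (degreeLE R w).subtype

theorem slash_sub_mem_baseKernel (hw : Even w) {γ : SL(2, ℤ)}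
    (hγ : γ ∈ CongruenceSubgroup.Gamma0 N) (v : V w R) :
    (slash w R γ v : R[X]) - v ∈ baseKernel N w R := by
  refine ⟨slash w R γ v - v, ?_, rfl⟩
  have := Submodule.neg_mem _ (single_sub_single_mem (R := R) hw (baseCoset N) γ v)
  rwa [baseCoset_mulRight hγ, neg_sub, ← map_sub] at this

theorem kerS_sup_kerU_eq_top [Finite (Cosets N)] (hw : Even w)
    (h : degreeLE R w ≤ baseKernel N w R) : kerS N w R ⊔ kerU N w R = ⊤ := by
  have := Fintype.ofFinite (Cosets N)
  refine eq_top_iff.mpr fun P _ => ?_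
  rw [eq_sum_single P]
  refine Submodule.sum_mem _ fun A _ => ?_
  obtain ⟨g, hg⟩ := exists_baseCoset_mulRight A
  have h1 := single_sub_single_mem hw A g (P A)
  obtain ⟨v, hv, hv'⟩ := h (slash w R g (P A)).2
  obtain rfl : v = slash w R g (P A) := Subtype.ext hv'
  rw [hg] at h1
  simpa using Submodule.add_mem _ h1 hv

/-! ### Weight zero: the sum over cosets -/

theorem mem_kerS_sup_kerU_of_sum_eq_zero [Fintype (Cosets N)] {P : VN N 0 R}
    (h : ∑ A, P A = 0) : P ∈ kerS N 0 R ⊔ kerU N 0 R := by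
  have h0 : ∑ A, single (baseCoset N) (P A) = 0 := by rw [← map_sum, h, map_zero]
  -- Subtracting the total mass at the base coset, which is zero, leaves differences `single A v -
  -- single (baseCoset N) v`.
  rw [eq_sum_single P, ← sub_zero (∑ A, single A (P A)), ← h0, ← Finset.sum_sub_distrib]
  refine Submodule.sum_mem _ fun A _ => ?_
  obtain ⟨g, hg⟩ := exists_baseCoset_mulRight A
  simpa [hg, slash_weight_zero] using single_sub_single_mem (by simp) A g (P A)

theorem sum_act_zero [Fintype (Cosets N)] (γ : SL(2, ℤ)) (P : VN N 0 R) :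
    ∑ A, act N 0 R γ P A = ∑ A, P A := by
  simp only [act, LinearMap.coe_mk, AddHom.coe_mk, slash_weight_zero]
  exact Fintype.sum_bijective (fun A : Cosets N => A.mulRight γ⁻¹)
    ⟨fun A B hAB => by simpa [Cosets.mulRight_inv_eq_iff, Cosets.mulRight_mulRight,
      Cosets.mulRight_one] using hAB,
      fun B => ⟨B.mulRight γ, by simp [Cosets.mulRight_mulRight, Cosets.mulRight_one]⟩⟩
    _ _ fun _ => rfl

/-- The sum is invariant under the action, so summing the two kernel relations gives `2 ∑ Q = 0` and
`3 ∑ Q' = 0`. -/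
theorem sum_eq_zero_of_mem_kerS_sup_kerU [Fintype (Cosets N)] (h2 : IsUnit (2 : R))
    (h3 : IsUnit (3 : R)) {P : VN N 0 R} (hP : P ∈ kerS N 0 R ⊔ kerU N 0 R) :
    ∑ A, P A = 0 := by
  obtain ⟨Q, hQ, Q', hQ', rfl⟩ := Submodule.mem_sup.mp hP
  have e : ∑ A, Q A = 0 := by
    have := congrArg (fun f : VN N 0 R => ∑ A, f A) (mem_kerS.mp hQ)
    simp only [Pi.add_apply, Finset.sum_add_distrib, sum_act_zero, Pi.zero_apply,
      Finset.sum_const_zero] at this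
    rw [← h2.smul_eq_zero, ← this]
    module
  have e' : ∑ A, Q' A = 0 := by
    have := congrArg (fun f : VN N 0 R => ∑ A, f A) (mem_kerU.mp hQ')
    simp only [Pi.add_apply, Finset.sum_add_distrib, sum_act_zero, Pi.zero_apply,
      Finset.sum_const_zero] at this
    rw [← h3.smul_eq_zero, ← this]
    module
  simp [Finset.sum_add_distrib, e, e']

/-! ### Positive weight: the coinvariants vanish -/

theorem degreeLT_succ_le {K : Submodule R R[X]} {n : ℕ} (h : degreeLT R n ≤ K) {p : R[X]}
    (hp : p ∈ K) (hd : p.natDegree ≤ n) (hu : IsUnit (p.coeff n)) : degreeLT R (n + 1) ≤ K := by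
  intro q hq
  obtain ⟨u, hu⟩ := hu
  have key : q - (q.coeff n * ↑u⁻¹) • p ∈ degreeLT R n := by
    rw [mem_degreeLT, degree_lt_iff_coeff_zero]
    intro m hm
    rcases hm.eq_or_lt with rfl | hm
    · simp [← hu]
    · have h1 := (degree_lt_iff_coeff_zero _ _).mp (mem_degreeLT.mp hq) m hm
      simp [h1, coeff_eq_zero_of_natDegree_lt (hd.trans_lt hm)]
  simpa using K.add_mem (h key) (K.smul_mem (q.coeff n * ↑u⁻¹) hp)

theorem degreeLE_eq_degreeLT_succ (n : ℕ) : degreeLE R n = degreeLT R (n + 1) := by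
  ext p
  rw [mem_degreeLE, mem_degreeLT, degree_le_iff_coeff_zero, degree_lt_iff_coeff_zero]
  exact ⟨fun h m hm => h m (by exact_mod_cast hm), fun h m hm => h m (by exact_mod_cast hm)⟩

/-- The monomial `X ^ i` as an element of `V_w`. -/
def monomialV (R : Type*) [CommRing R] {i : ℕ} (hi : i ≤ w) : V w R :=
  ⟨X ^ i, mem_degreeLE.mpr ((degree_X_pow_le i).trans (by exact_mod_cast hi))⟩

/-- The translation `T` applied to `X ^ (n + 1)` yields an element of degree `n`. Degree `w` itself
is out of reach, since `X ^ (w + 1)` is not in `V w R`. -/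
theorem degreeLT_le_baseKernel (hw : Even w) (hu : ∀ i : ℕ, 0 < i → i ≤ w → IsUnit (i : R))
    {n : ℕ} (hn : n ≤ w) : degreeLT R n ≤ baseKernel N w R := by
  induction n with
  | zero =>
    intro p hp
    rw [mem_degreeLT, Nat.cast_zero, Nat.WithBot.lt_zero_iff, degree_eq_bot] at hp
    simp [hp]
  | succ n ih =>
    have hT : ModularGroup.T ∈ CongruenceSubgroup.Gamma0 N :=
      CongruenceSubgroup.Gamma0_mem.mpr (by simp [ModularGroup.T])
    have key := slash_sub_mem_baseKernel (R := R) hw hT (monomialV R hn)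
    rw [coe_slash_X_pow _ _ rfl hn] at key
    have e : rowForm R ModularGroup.T 0 ^ (n + 1) * rowForm R ModularGroup.T 1 ^ (w - (n + 1)) -
        (monomialV R hn : R[X]) = (X + 1) ^ (n + 1) - X ^ (n + 1) := by
      simp [rowForm, ModularGroup.T, monomialV]
    rw [e] at key
    refine degreeLT_succ_le (ih (by omega)) key ?_ ?_
    · rw [natDegree_le_iff_coeff_eq_zero]
      intro m hm
      rw [coeff_sub, coeff_X_add_one_pow, coeff_X_pow]
      rcases (Nat.succ_le_of_lt hm).eq_or_lt with rfl | h
      · simp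
      · rw [Nat.choose_eq_zero_of_lt h]
        simp [h.ne']
    · rw [coeff_sub, coeff_X_add_one_pow, coeff_X_pow]
      simpa using hu (n + 1) n.succ_pos hn

theorem degreeLE_le_baseKernel (hw : Even w) (hu : ∀ i : ℕ, 0 < i → i ≤ w → IsUnit (i : R))
    {p : R[X]} (hp : p ∈ baseKernel N w R) (hc : IsUnit (p.coeff w)) :
    degreeLE R w ≤ baseKernel N w R := by
  rw [degreeLE_eq_degreeLT_succ]
  refine degreeLT_succ_le (degreeLT_le_baseKernel hw hu le_rfl) hp ?_ hc
  obtain ⟨v, -, rfl⟩ := hp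
  exact natDegree_le_of_V v

theorem degreeLE_le_baseKernel_of_isUnit_level (hw : Even w) (hw0 : w ≠ 0)
    (hu : ∀ i : ℕ, 0 < i → i ≤ w → IsUnit (i : R)) (hN : IsUnit (N : R)) :
    degreeLE R w ≤ baseKernel N w R := by
  -- This matrix sends `1` to `(N X + 1) ^ w`, with top coefficient `N ^ w`; subtracting `1` does
  -- not affect it since `w ≠ 0`.
  let γ : SL(2, ℤ) := ⟨!![1, 0; N, 1], by simp [Matrix.det_fin_two]⟩
  have hγ : γ ∈ CongruenceSubgroup.Gamma0 N := CongruenceSubgroup.Gamma0_mem.mpr (by simp [γ])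
  refine degreeLE_le_baseKernel hw hu
    (slash_sub_mem_baseKernel (R := R) hw hγ (monomialV R (Nat.zero_le w))) ?_
  rw [coe_slash_X_pow _ _ rfl (Nat.zero_le w), pow_zero, one_mul, Nat.sub_zero, coeff_sub]
  have h1 := coeff_pow_of_natDegree_le (m := w) (natDegree_rowForm_le (R := R) γ 1)
  rw [mul_one] at h1
  rw [h1]
  simpa [rowForm, γ, monomialV, coeff_one, hw0, coeff_natCast_ite] using hN.pow w

theorem degreeLE_le_baseKernel_of_isUnit_pow_sub_one (hw : Even w)
    (hu : ∀ i : ℕ, 0 < i → i ≤ w → IsUnit (i : R)) {a : ℤ} (ha : IsCoprime a N)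
    (h : IsUnit ((a : R) ^ w - 1)) : degreeLE R w ≤ baseKernel N w R := by
  obtain ⟨d, b, hab⟩ := ha
  -- It sends `X ^ w` to `(a X - b) ^ w`, so the difference has top coefficient `a ^ w - 1`.
  let γ : SL(2, ℤ) := ⟨!![a, -b; N, d], by simp [Matrix.det_fin_two]; linarith⟩
  have hγ : γ ∈ CongruenceSubgroup.Gamma0 N := CongruenceSubgroup.Gamma0_mem.mpr (by simp [γ])
  refine degreeLE_le_baseKernel hw hu
    (slash_sub_mem_baseKernel (R := R) hw hγ (monomialV R le_rfl)) ?_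
  rw [coe_slash_X_pow _ _ rfl le_rfl, Nat.sub_self, pow_zero, mul_one, coeff_sub]
  have h1 := coeff_pow_of_natDegree_le (m := w) (natDegree_rowForm_le (R := R) γ 0)
  rw [mul_one] at h1
  rw [h1]
  have h2 : (rowForm R γ 0).coeff 1 = a := by
    simp only [rowForm, coeff_add, coeff_C_mul, coeff_X_one, mul_one, coeff_C_succ, add_zero]
    simp [γ]
  simpa [h2, monomialV] using h

/-- A generator of `(ZMod ℓ)ˣ` has order `ℓ - 1 > w`, and it lifts to a unit modulo `N`. -/
theorem exists_isCoprime_not_dvd_pow_sub_one {ℓ : ℕ} [Fact ℓ.Prime] (hN : N ≠ 0) (hℓN : ℓ ∣ N)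
    (hw0 : w ≠ 0) (hw : w < ℓ - 1) : ∃ a : ℤ, IsCoprime a N ∧ ¬ (ℓ : ℤ) ∣ a ^ w - 1 := by
  have : NeZero N := ⟨hN⟩
  obtain ⟨u, hu⟩ := IsCyclic.exists_generator (α := (ZMod ℓ)ˣ)
  obtain ⟨v, hv⟩ := ZMod.unitsMap_surjective hℓN u
  refine ⟨(v : ZMod N).val, ?_, ?_⟩
  · exact Nat.isCoprime_iff_coprime.mpr (ZMod.val_coe_unit_coprime v)
  · rw [← ZMod.intCast_zmod_eq_zero_iff_dvd]
    have hval : (((v : ZMod N).val : ℕ) : ZMod ℓ) = u := by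
      rw [← hv, ZMod.unitsMap_val, ZMod.natCast_val]
    push_cast
    rw [hval, sub_eq_zero]
    intro h
    have h1 : u ^ w = 1 := Units.ext (by simpa using h)
    have h2 := Nat.le_of_dvd (Nat.pos_of_ne_zero hw0) (orderOf_dvd_of_pow_eq_one h1)
    rw [orderOf_eq_card_of_forall_mem_zpowers hu, Nat.card_eq_fintype_card,
      ZMod.card_units] at h2
    omega

/-! ### Lifting period polynomials from the residue field -/

theorem mapVN_surjective {R' : Type*} [CommRing R'] {f : R →+* R'}
    (hf : Function.Surjective f) : Function.Surjective (mapVN N w f) := by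
  intro P
  have h (A : Cosets N) : ∃ Q : V w R, mapV w f Q = P A := by
    have hl : (P A : R'[X]) ∈ lifts f := by
      rw [lifts_iff_coeff_lifts]
      exact fun n => hf _
    obtain ⟨q, hq, hd⟩ := exists_degree_eq_of_mem_lifts hl
    exact ⟨⟨q, mem_degreeLE.mpr (hd.trans_le (mem_degreeLE.mp (P A).2))⟩, Subtype.ext hq⟩
  choose Q hQ using h
  exact ⟨Q, funext hQ⟩

theorem exists_eq_smul_of_mapVN_eq_zero [IsDomain R] [IsLocalRing R] {ϖ : R} (hϖ : ϖ ≠ 0)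
    (hmax : IsLocalRing.maximalIdeal R = Ideal.span {ϖ}) {P : VN N w R}
    (hP : mapVN N w (IsLocalRing.residue R) P = 0) : ∃ Q, P = ϖ • Q := by
  have h (A : Cosets N) : ∃ Q : V w R, P A = ϖ • Q := by
    have hA : (P A : R[X]).map (IsLocalRing.residue R) = 0 :=
      congrArg Subtype.val (congrFun hP A)
    have hdvd : C ϖ ∣ (P A : R[X]) := by
      rw [C_dvd_iff_dvd_coeff]
      intro i
      rw [← Ideal.mem_span_singleton, ← hmax, ← IsLocalRing.residue_eq_zero_iff, ← coeff_map, hA,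
        coeff_zero]
    obtain ⟨q, hq⟩ := hdvd
    have hd := mem_degreeLE.mp (P A).2
    rw [hq, degree_C_mul hϖ] at hd
    exact ⟨⟨q, mem_degreeLE.mpr hd⟩, Subtype.ext (by simpa [smul_eq_C_mul] using hq)⟩
  choose Q hQ using h
  exact ⟨Q, funext hQ⟩

theorem isUnit_intCast_of_not_dvd [IsLocalRing R] (ℓ : ℕ)
    [CharP (IsLocalRing.ResidueField R) ℓ] {n : ℤ} (hn : ¬ (ℓ : ℤ) ∣ n) : IsUnit (n : R) := by
  rw [← IsLocalRing.residue_ne_zero_iff_isUnit, map_intCast, Ne,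
    CharP.intCast_eq_zero_iff (IsLocalRing.ResidueField R) ℓ]
  exact hn

theorem isUnit_natCast_of_not_dvd [IsLocalRing R] (ℓ : ℕ)
    [CharP (IsLocalRing.ResidueField R) ℓ] {n : ℕ} (hn : ¬ ℓ ∣ n) : IsUnit (n : R) := by
  simpa using isUnit_intCast_of_not_dvd (R := R) ℓ (n := n) (by exact_mod_cast hn)

theorem smul_sub_eq_self {K E : Type*} [CommRing K] [AddCommGroup E] [Module K E] {r : K}
    (hr : 2 * r = 1) {x y : E} (h : x + y = 0) : r • (x - y) = x := by
  rw [eq_neg_of_add_eq_zero_right h, sub_neg_eq_add, ← two_smul K x, smul_smul, mul_comm, hr,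
    one_smul]

theorem smul_sub_add_sub_eq_self {K E : Type*} [CommRing K] [AddCommGroup E] [Module K E] {r : K}
    (hr : 3 * r = 1) {x y z : E} (h : x + y + z = 0) : r • ((x - y) + (x - z)) = x := by
  have e : (x - y) + (x - z) = (3 : K) • x := by
    rw [eq_neg_of_add_eq_zero_right h]
    module
  rw [e, smul_smul, mul_comm, hr, one_smul]

/-- If the quotient of `V_w(N)` by `ker (1 + S) + ker (1 + U + U²)` has no torsion for a
uniformizer, every period polynomial over the residue field lifts. -/
theorem reduction_surjective_of_torsionFree [IsDomain R] [IsLocalRing R] (hw : Even w)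
    (h2 : IsUnit (2 : R)) (h3 : IsUnit (3 : R)) {ϖ : R} (hϖ : ϖ ≠ 0)
    (hmax : IsLocalRing.maximalIdeal R = Ideal.span {ϖ})
    (htf : ∀ P : VN N w R, ϖ • P ∈ kerS N w R ⊔ kerU N w R → P ∈ kerS N w R ⊔ kerU N w R) :
    Function.Surjective (reduction N w R) := by
  rintro ⟨P, hP⟩
  obtain ⟨hPS, hPU⟩ := Submodule.mem_inf.mp hP
  rw [← kerS, mem_kerS] at hPS
  rw [← kerU, mem_kerU] at hPU
  obtain ⟨Q, rfl⟩ := mapVN_surjective (N := N) (w := w) (IsLocalRing.residue_surjective (R := R)) P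
  obtain ⟨r, hr⟩ := h2.exists_right_inv
  obtain ⟨s, hs⟩ := h3.exists_right_inv
  set f := IsLocalRing.residue R with hf
  have hr' : 2 * f r = 1 := by simpa only [map_mul, map_ofNat, map_one] using congrArg f hr
  have hs' : 3 * f s = 1 := by simpa only [map_mul, map_ofNat, map_one] using congrArg f hs
  -- `(1 - S) / 2` maps into `kerS` and is the identity there; `((1 - U) + (1 - U²)) / 3` does the
  -- same for `kerU`. Hence `A` and `B` both still reduce to the given `P`.
  set A := r • (Q - act N w R S Q) with hAdef
  set B := s • ((Q - act N w R U Q) + (Q - act N w R (U ^ 2) Q)) with hBdef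
  have hA : A ∈ kerS N w R := Submodule.smul_mem _ _ (sub_act_S_mem_kerS hw Q)
  have hB : B ∈ kerU N w R := Submodule.smul_mem _ _
    (Submodule.add_mem _ (sub_act_U_mem_kerU hw Q) (sub_act_U_sq_mem_kerU hw Q))
  have hAP : mapVN N w f A = mapVN N w f Q := by
    rw [hAdef, LinearMap.map_smulₛₗ, map_sub, mapVN_act]
    exact smul_sub_eq_self hr' hPS
  have hBP : mapVN N w f B = mapVN N w f Q := by
    rw [hBdef, LinearMap.map_smulₛₗ, map_add, map_sub, map_sub, mapVN_act, mapVN_act]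
    exact smul_sub_add_sub_eq_self hs' hPU
  obtain ⟨Z, hZ⟩ := exists_eq_smul_of_mapVN_eq_zero (N := N) (w := w) hϖ hmax (P := A - B)
    (by rw [map_sub, ← hf, hAP, hBP, sub_self])
  have hZmem : Z ∈ kerS N w R ⊔ kerU N w R := by
    apply htf
    rw [← hZ]
    exact Submodule.sub_mem _ (Submodule.mem_sup_left hA) (Submodule.mem_sup_right hB)
  obtain ⟨A', hA', B', hB', rfl⟩ := Submodule.mem_sup.mp hZmem
  -- Splitting `A - B = ϖ • (A' + B')` gives one element lying in both kernels and congruent to `A`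
  -- modulo `ϖ`.
  have hAB : A - ϖ • A' = B + ϖ • B' := by
    rw [sub_eq_iff_eq_add.mp hZ]
    module
  have hmem : A - ϖ • A' ∈ W N w R := by
    refine Submodule.mem_inf.mpr ⟨?_, ?_⟩
    · exact Submodule.sub_mem (kerS N w R) hA (Submodule.smul_mem _ _ hA')
    · rw [hAB]
      exact Submodule.add_mem (kerU N w R) hB (Submodule.smul_mem _ _ hB')
  refine ⟨⟨_, hmem⟩, Subtype.ext ?_⟩
  have hϖ0 : f ϖ = 0 := by
    rw [hf, IsLocalRing.residue_eq_zero_iff, hmax]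
    exact Ideal.mem_span_singleton_self ϖ
  change mapVN N w f (A - ϖ • A') = _
  rw [map_sub, hAP, LinearMap.map_smulₛₗ, hϖ0, zero_smul, sub_zero]

end

end PeriodPolynomial

open PeriodPolynomial in
theorem propositionP2 (N : ℕ) (hN : 1 ≤ N) (w : ℕ) (hw : Even w)
    (R : Type*) [CommRing R] [IsDomain R] [IsDiscreteValuationRing R]
    (ℓ : ℕ) [CharP (IsLocalRing.ResidueField R) ℓ]
    (hℓw : w < ℓ) (hℓ2 : ℓ ≠ 2) (hℓ3 : ℓ ≠ 3)
    (hℓN : ¬ (ℓ ∣ N ∧ w = ℓ - 1)) :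
    Function.Surjective (PeriodPolynomial.reduction N w R) := by
  have : NeZero N := ⟨by omega⟩
  have hℓ : ℓ.Prime := (CharP.char_is_prime_or_zero (IsLocalRing.ResidueField R) ℓ).resolve_right
    (by omega)
  have : Fact ℓ.Prime := ⟨hℓ⟩
  have h2 : IsUnit (2 : R) := by
    exact_mod_cast isUnit_natCast_of_not_dvd (R := R) ℓ (n := 2)
      (by rwa [Nat.prime_dvd_prime_iff_eq hℓ Nat.prime_two])
  have h3 : IsUnit (3 : R) := by
    exact_mod_cast isUnit_natCast_of_not_dvd (R := R) ℓ (n := 3)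
      (by rwa [Nat.prime_dvd_prime_iff_eq hℓ Nat.prime_three])
  obtain ⟨ϖ, hirr⟩ := IsDiscreteValuationRing.exists_irreducible R
  have hfin : Finite (Cosets N) := Finite.of_equiv _
    (QuotientGroup.quotientRightRelEquivQuotientLeftRel (CongruenceSubgroup.Gamma0 N)).symm
  refine reduction_surjective_of_torsionFree hw h2 h3 hirr.ne_zero hirr.maximalIdeal_eq ?_
  rcases eq_or_ne w 0 with rfl | hw0
  · intro P hP
    have := Fintype.ofFinite (Cosets N)
    have h := sum_eq_zero_of_mem_kerS_sup_kerU h2 h3 hP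
    simp only [Pi.smul_apply, ← Finset.smul_sum] at h
    exact mem_kerS_sup_kerU_of_sum_eq_zero ((smul_eq_zero.mp h).resolve_left hirr.ne_zero)
  · have hu (i : ℕ) (hi : 0 < i) (hiw : i ≤ w) : IsUnit (i : R) :=
      isUnit_natCast_of_not_dvd ℓ (Nat.not_dvd_of_pos_of_lt hi (by omega))
    -- In positive weight the quotient is zero, so there is no torsion to exclude.
    rw [kerS_sup_kerU_eq_top hw]
    · simp
    by_cases hdvd : ℓ ∣ N
    · obtain ⟨a, ha, ha'⟩ := exists_isCoprime_not_dvd_pow_sub_one (w := w) (NeZero.ne N) hdvd hw0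
        (by have : w ≠ ℓ - 1 := fun h => hℓN ⟨hdvd, h⟩
            omega)
      refine degreeLE_le_baseKernel_of_isUnit_pow_sub_one hw hu ha ?_
      exact_mod_cast isUnit_intCast_of_not_dvd (R := R) ℓ ha'
    · exact degreeLE_le_baseKernel_of_isUnit_level hw hw0 hu (isUnit_natCast_of_not_dvd ℓ hdvd)
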